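/- Let $n\in\mathbb N$, $m\in\{0,\dots,n-1\}$, $s>m$ and $0<\alpha\le 1$. Then there is a constant $c=c(n,m,s,\alpha)>0$, depending only on $n,m,s,\alpha$, such that for every finite Borel regular (outer) measure $\mu$ on $\mathbb R^n$ with $\dim_H(\mu)\ge s$, $$\limsup_{r\downarrow 0}\ \inf_{\substack{\theta\in S^{n-1}\\ V\in G(n,n-m)}}\frac{\mu\bigl(X(x,r,V,\alpha)\setminus H(x,\theta,\alpha)\bigr)}{\mu\bigl(B(x,r)\bigr)}>c\qquad\text{for }\mu\text{-almost every }x\in\mathbb R^n .$$ Here $|\cdot|$ is the Euclidean norm, $B(x,r)$ is the closed ball, $S^{n-1}$ is the unit sphere, $G(n,n-m)$ is the set of all $(n-m)$-dimensional linear subspaces of $\mathbb R^n$, $$H(x,\theta,\alpha)=\{y\in\mathbb R^n:(y-x)\cdot\theta>\alpha|y-x|\},\qquad X(x,r,V,\alpha)=\{y\in B(x,r):\operatorname{dist}(y-x,V)<\alpha|y-x|\},$$ and $\dim_H(\mu)=\inf\{\dim_H(A): A\subset\mathbb R^n\text{ Borel},\ \mu(A)>0\}$, where $\dim_H(A)$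 is the Hausdorff dimension of the set $A$. -/

import Mathlib

open Filter Topology MeasureTheory
open scoped ENNReal

noncomputable section

namespace ConicalDensity

/-- `ℝⁿ` with its Euclidean norm and inner product. -/
abbrev Rn (n : ℕ) : Type := EuclideanSpace ℝ (Fin n)

/-- The unit sphere `S^{n-1}` of `ℝⁿ`. -/
def unitSphere (n : ℕ) : Set (Rn n) := Metric.sphere 0 1

/-- The Grassmannian `G(n,k)`: all `k`-dimensional linear subspaces of `ℝⁿ`. -/
def grassmannian (n k : ℕ) : Set (Submodule ℝ (Rn n)) := {V | Module.finrank ℝ V = k}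

/-- `H(x,θ,α) = {y : (y - x) · θ > α |y - x|}`. -/
def H {n : ℕ} (x θ : Rn n) (α : ℝ) : Set (Rn n) :=
  {y | inner ℝ (y - x) θ > α * ‖y - x‖}

/-- The two-sided cone `X(x,V,α) = {y : dist(y - x, V) < α |y - x|}` around `x + V`. -/
def cone {n : ℕ} (x : Rn n) (V : Submodule ℝ (Rn n)) (α : ℝ) : Set (Rn n) :=
  {y | Metric.infDist (y - x) (V : Set (Rn n)) < α * ‖y - x‖}

/-- The truncated cone `X(x,r,V,α) = B(x,r) ∩ X(x,V,α)`, where `B(x,r)` is the closed ball. -/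
def truncCone {n : ℕ} (x : Rn n) (r : ℝ) (V : Submodule ℝ (Rn n)) (α : ℝ) : Set (Rn n) :=
  Metric.closedBall x r ∩ cone x V α

/-- The (lower) Hausdorff dimension of a measure:
`dim_H μ = inf {dim_H A : A Borel, μ A > 0}`, an element of `[0,∞]`. -/
def hausdorffDim {n : ℕ} (μ : Measure (Rn n)) : ℝ≥0∞ :=
  ⨅ (A : Set (Rn n)) (_ : MeasurableSet A) (_ : 0 < μ A), dimH A

end ConicalDensity

end

/-! Fix `m < d < s` and suppose that, on a set `S` of positive measure, at every small scale some
cone minus a half-space carries at most `c` times the mass of the ball. For `c` small this produces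
a set of positive measure and dimension at most `d`, contradicting `dim μ ≥ s`.

Split cubes of side `B⁻ᵏ` into children of side `B⁻ᵏ⁻¹`, and call a child light if its mass in a
compact set `K` is at most `c` times that of the neighbourhood of its parent. At most `C₀ Bᵐ`
children are heavy, with `C₀` independent of `B` (`exists_card_heavy_children_le`). Indeed, choose
points `y`, `y'` of `S` in two well-separated heavy children, with nearly the same directions `θ`,
`V` and nearly equal coordinates normal to `V`. The child of `y'` lies in the cone at `y` but is too
heavy to avoid the half-space there, so `y' - y` points along `θ`; by symmetry so does `y - y'`,
which is absurd.

Light cubes of one generation carry little mass of `K` (`measure_lightCubes_le`). By Markov, on at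
least half of `K` at most `l` of the first `D l` steps are light. By
`exists_card_le_of_few_bad_steps` these points lie in `O(((2 C₀ Bᵐ)ᴰ Bⁿ)ˡ)` cubes of side at most
`B⁻ᴰˡ`. For `D`, and then `B`, large, the sums of `d`-th powers of diameters are summable over `l`,
so the limsup of these sets is null for `μH[d]`, although its `μ`-measure is at least `μ K / 2`. -/

namespace ConicalDensity

/-! ### Counting paths in a tree -/

/-- Counting paths in a tree in which all but few steps lead to one of few good children. -/
theorem exists_card_le_of_few_bad_steps {ι : Type*} (children : ι → Finset ι)
    (bad : ℕ → Set ι) {N M : ℕ} (hN : 1 ≤ N)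
    (hM : ∀ p, (children p).card ≤ M)
    (hgood : ∀ j p, ∃ G : Finset ι, G.card ≤ N ∧ ∀ q ∈ children p, q ∉ bad j → q ∈ G)
    (F₀ : Finset ι) (J b : ℕ) :
    ∃ F : Finset ι, F.card ≤ F₀.card * (2 * N) ^ J * M ^ b ∧
      ∀ q : ℕ → ι, q 0 ∈ F₀ → (∀ j, q (j + 1) ∈ children (q j)) →
        ∑ j ∈ Finset.range J, (bad j).indicator (fun _ => (1 : ℕ)) (q (j + 1)) ≤ b → q J ∈ F := by
  classical
  choose G hG hG' using hgood
  induction J generalizing b with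
  | zero =>
    by_cases hne : F₀ = ∅
    · exact ⟨∅, by simp, fun q h => by simp [hne] at h⟩
    -- If `M = 0` and `b > 0`, the bound is zero; the empty set then works because no path can take
    -- a first step.
    by_cases hM0 : M = 0
    · refine ⟨∅, by simp, fun q _ h => ?_⟩
      have h1 := Finset.card_pos.2 ⟨_, h 0⟩
      have h2 := hM (q 0)
      omega
    · refine ⟨F₀, ?_, fun q h _ _ => h⟩
      have : 1 ≤ M ^ b := Nat.one_le_pow _ _ (by omega)
      simpa using Nat.le_mul_of_pos_right _ this
  | succ J ih =>
    obtain ⟨F, hF, hF'⟩ := ih b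
    cases b with
    | zero =>
      refine ⟨F.biUnion (G J), ?_, fun q h0 hq hb => ?_⟩
      · refine (Finset.card_biUnion_le_card_mul _ _ N fun p _ => hG J p).trans ?_
        calc F.card * N ≤ (F₀.card * (2 * N) ^ J * M ^ 0) * (2 * N) := by gcongr; omega
          _ = _ := by ring
      · rw [Finset.sum_range_succ] at hb
        have h1 : ∑ j ∈ Finset.range J, (bad j).indicator (fun _ => (1 : ℕ)) (q (j + 1)) ≤ 0 := by
          omega
        have h2 : q (J + 1) ∉ bad J := by
          intro h
          rw [Set.indicator_of_mem h] at hb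
          omega
        exact Finset.mem_biUnion.2 ⟨q J, hF' q h0 hq h1, hG' J _ _ (hq J) h2⟩
    | succ b =>
      obtain ⟨E, hE, hE'⟩ := ih b
      refine ⟨F.biUnion (G J) ∪ E.biUnion children, ?_, fun q h0 hq hb => ?_⟩
      · refine (Finset.card_union_le _ _).trans ((Nat.add_le_add
          (Finset.card_biUnion_le_card_mul _ _ N fun p _ => hG J p)
          (Finset.card_biUnion_le_card_mul _ _ M fun p _ => hM p)).trans ?_)
        -- A last good step costs a factor `N`; a last bad step costs `M` but uses up one unit of
        -- `b`. The factor `2` in `2 * N` absorbs the choice of the positions of the bad steps.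
        calc F.card * N + E.card * M
            ≤ (F₀.card * (2 * N) ^ J * M ^ (b + 1)) * N + (F₀.card * (2 * N) ^ J * M ^ b) * M := by
              gcongr
          _ = (F₀.card * (2 * N) ^ J * M ^ (b + 1)) * (N + 1) := by ring
          _ ≤ (F₀.card * (2 * N) ^ J * M ^ (b + 1)) * (2 * N) := by gcongr; omega
          _ = _ := by ring
      · rw [Finset.sum_range_succ] at hb
        by_cases h : q (J + 1) ∈ bad J
        · rw [Set.indicator_of_mem h] at hb
          exact Finset.mem_union_right _ (Finset.mem_biUnion.2
            ⟨q J, hE' q h0 hq (by omega), hq J⟩)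
        · rw [Set.indicator_of_notMem h] at hb
          exact Finset.mem_union_left _ (Finset.mem_biUnion.2
            ⟨q J, hF' q h0 hq (by omega), hG' J _ _ (hq J) h⟩)

/-! ### Grid cubes and their neighbourhoods -/

/-- The index of the grid cube of side length `B⁻ᵏ` containing `x`. -/
noncomputable def cubeIndex {n : ℕ} (B k : ℕ) (x : Rn n) : Fin n → ℤ := fun i => ⌊x i * (B : ℝ) ^ k⌋

/-- The half-open grid cube of side length `B⁻ᵏ` with index `q`. -/
def cube {n : ℕ} (B k : ℕ) (q : Fin n → ℤ) : Set (Rn n) := {x | cubeIndex B k x = q}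

/-- The union of the grid cubes of side length `B⁻ᵏ` whose indices differ from `p` by at most `n`
in each coordinate. -/
def nearCubes {n : ℕ} (B k : ℕ) (p : Fin n → ℤ) : Set (Rn n) :=
  {x | ∀ i, |cubeIndex B k x i - p i| ≤ n}

/-- The indices of the cubes of the next generation contained in the cube with index `p`. -/
noncomputable def childIndices {n : ℕ} (B : ℕ) (p : Fin n → ℤ) : Finset (Fin n → ℤ) :=
  Fintype.piFinset fun i => Finset.Ico (B * p i) (B * p i + B)

theorem card_childIndices {n : ℕ} (B : ℕ) (p : Fin n → ℤ) :
    (childIndices B p).card = B ^ n := by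
  simp [childIndices]

theorem mem_childIndices {n B : ℕ} (hB : 0 < B) {p q : Fin n → ℤ} :
    q ∈ childIndices B p ↔ ∀ i, q i / B = p i := by
  simp only [childIndices, Fintype.mem_piFinset, Finset.mem_Ico]
  refine forall_congr' fun i => ?_
  have hB' : (0 : ℤ) < B := by exact_mod_cast hB
  rw [Int.ediv_eq_iff_of_pos hB']
  constructor <;> rintro ⟨h1, h2⟩ <;> constructor <;> linarith

theorem cubeIndex_succ_mem_childIndices {n B : ℕ} (hB : 0 < B) (k : ℕ) (x : Rn n) :
    cubeIndex B (k + 1) x ∈ childIndices B (cubeIndex B k x) := by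
  rw [mem_childIndices hB]
  intro i
  simp only [cubeIndex]
  rw [pow_succ, ← mul_assoc, Int.mul_natCast_floor_div_cancel hB.ne']

theorem cube_subset_of_mem_childIndices {n B : ℕ} (hB : 0 < B) {k : ℕ} {p q : Fin n → ℤ}
    (h : q ∈ childIndices B p) : cube B (k + 1) q ⊆ cube B k p := by
  intro x hx
  have := (mem_childIndices hB).1 (cubeIndex_succ_mem_childIndices hB k x)
  have h' := (mem_childIndices hB).1 h
  rw [show cubeIndex B (k + 1) x = q from hx] at this
  exact funext fun i => (this i).symm.trans (h' i)

theorem measurable_cubeIndex {n : ℕ} (B k : ℕ) : Measurable (cubeIndex (n := n) B k) := by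
  refine measurable_pi_lambda _ fun i => Int.measurable_floor.comp ?_
  fun_prop

theorem measurableSet_cube {n : ℕ} (B k : ℕ) (q : Fin n → ℤ) : MeasurableSet (cube B k q) :=
  measurable_cubeIndex B k (MeasurableSet.singleton q)

theorem tsum_measure_cube_inter_le {n : ℕ} (μ : Measure (Rn n)) (B k : ℕ) {U : Set (Rn n)}
    (hU : MeasurableSet U) : ∑' q, μ (cube B k q ∩ U) ≤ μ U := by
  refine (tsum_meas_le_meas_iUnion_of_disjoint μ
    (fun q => (measurableSet_cube B k q).inter hU) ?_).trans
    (measure_mono (Set.iUnion_subset fun q => Set.inter_subset_right))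
  intro p q hpq
  refine Set.disjoint_left.2 fun x hx hx' => hpq ?_
  exact hx.1.symm.trans hx'.1

theorem norm_le_of_forall_abs_le {n : ℕ} {x : Rn n} {d : ℝ} (hd : 0 ≤ d)
    (h : ∀ i, |x i| ≤ d) : ‖x‖ ≤ n * d := by
  rw [EuclideanSpace.norm_eq]
  refine Real.sqrt_le_iff.2 ⟨by positivity, ?_⟩
  calc ∑ i, ‖x i‖ ^ 2 ≤ ∑ _i : Fin n, d ^ 2 := by
        gcongr with i _
        exact h i
    _ = n * d ^ 2 := by simp
    _ ≤ (n * d) ^ 2 := by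
        rw [mul_pow]
        gcongr
        exact_mod_cast Nat.le_self_pow two_ne_zero n

theorem abs_apply_le_norm {n : ℕ} (x : Rn n) (i : Fin n) : |x i| ≤ ‖x‖ :=
  PiLp.norm_apply_le x i

theorem norm_sub_le_of_mem_cube {n B k : ℕ} (hB : 0 < B) {q : Fin n → ℤ} {x y : Rn n}
    (hx : x ∈ cube B k q) (hy : y ∈ cube B k q) : ‖x - y‖ ≤ n * ((B : ℝ) ^ k)⁻¹ := by
  have hB' : (0 : ℝ) < (B : ℝ) ^ k := by positivity
  refine norm_le_of_forall_abs_le (by positivity) fun i => ?_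
  have h : ⌊x i * (B : ℝ) ^ k⌋ = ⌊y i * (B : ℝ) ^ k⌋ := congrFun (hx.trans hy.symm) i
  have h1 := (Int.abs_sub_lt_one_of_floor_eq_floor h).le
  rw [← sub_mul, abs_mul, abs_of_pos hB'] at h1
  rw [← one_div, le_div_iff₀ hB']
  simpa using h1

/-- The radius is the crude bound for the diameter of a cube of generation `k`. A ball of this
radius thus contains the cube of its centre, while its mass is bounded by a quantity depending only
on that cube. -/
theorem closedBall_subset_nearCubes {n B k : ℕ} (hB : 0 < B) (x : Rn n) :
    Metric.closedBall x (n * ((B : ℝ) ^ k)⁻¹) ⊆ nearCubes B k (cubeIndex B k x) := by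
  intro y hy i
  have hB' : (0 : ℝ) < (B : ℝ) ^ k := by positivity
  rw [mem_closedBall_iff_norm] at hy
  have h1 := (abs_apply_le_norm (y - x) i).trans hy
  rw [← div_eq_mul_inv, le_div_iff₀ hB', ← abs_of_pos hB', ← abs_mul] at h1
  have h2 : |y i * (B : ℝ) ^ k - x i * (B : ℝ) ^ k| ≤ n := by
    rw [← sub_mul]; simpa using h1
  rw [abs_le] at h2
  simp only [cubeIndex]
  have a1 := Int.floor_le (y i * (B : ℝ) ^ k)
  have a2 := Int.lt_floor_add_one (y i * (B : ℝ) ^ k)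
  have a3 := Int.floor_le (x i * (B : ℝ) ^ k)
  have a4 := Int.lt_floor_add_one (x i * (B : ℝ) ^ k)
  generalize ⌊y i * (B : ℝ) ^ k⌋ = a at *
  generalize ⌊x i * (B : ℝ) ^ k⌋ = b at *
  have e1 : ((a - b : ℤ) : ℝ) < (n + 1 : ℤ) := by push_cast; linarith
  have e2 : ((-(n + 1) : ℤ) : ℝ) < (a - b : ℤ) := by push_cast; linarith
  have e1' := Int.cast_lt.1 e1
  have e2' := Int.cast_lt.1 e2
  rw [abs_le]
  omega

theorem nearCubes_subset_closedBall {n B k : ℕ} (hB : 0 < B) (x : Rn n) :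
    nearCubes B k (cubeIndex B k x) ⊆
      Metric.closedBall x (n * ((n + 1) * ((B : ℝ) ^ k)⁻¹)) := by
  intro y hy
  have hB' : (0 : ℝ) < (B : ℝ) ^ k := by positivity
  rw [mem_closedBall_iff_norm]
  refine norm_le_of_forall_abs_le (by positivity) fun i => ?_
  have h := hy i
  simp only [cubeIndex] at h
  have a1 := Int.floor_le (y i * (B : ℝ) ^ k)
  have a2 := Int.lt_floor_add_one (y i * (B : ℝ) ^ k)
  have a3 := Int.floor_le (x i * (B : ℝ) ^ k)
  have a4 := Int.lt_floor_add_one (x i * (B : ℝ) ^ k)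
  have h' : |(⌊y i * (B : ℝ) ^ k⌋ : ℝ) - ⌊x i * (B : ℝ) ^ k⌋| ≤ n := by exact_mod_cast h
  rw [← div_eq_mul_inv, le_div_iff₀ hB', ← abs_of_pos hB', ← abs_mul]
  simp only [PiLp.sub_apply, sub_mul]
  rw [abs_le] at h' ⊢
  constructor <;> linarith

/-- Bounded overlap: a point lies in the neighbourhoods of only `(2n+1)ⁿ` cubes. -/
theorem measure_nearCubes_inter_le {n : ℕ} (μ : Measure (Rn n)) (B k : ℕ) {U : Set (Rn n)}
    (hU : MeasurableSet U) :
    ∑' p, μ (nearCubes B k p ∩ U) ≤ ((2 * n + 1) ^ n : ℕ) * μ U := by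
  set box : Finset (Fin n → ℤ) := Fintype.piFinset fun _ => Finset.Icc (-n : ℤ) n with hbox
  have hcard : box.card = (2 * n + 1) ^ n := by
    simp only [hbox, Fintype.card_piFinset, Int.card_Icc, Finset.prod_const, Finset.card_univ,
      Fintype.card_fin]
    congr 1
    omega
  have hsub : ∀ p, nearCubes B k p ∩ U ⊆ ⋃ e ∈ box, cube B k (p + e) ∩ U := by
    rintro p x ⟨hx, hxU⟩
    simp only [Set.mem_iUnion]
    refine ⟨cubeIndex B k x - p, ?_, ?_, hxU⟩
    · simp only [hbox, Fintype.mem_piFinset, Finset.mem_Icc]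
      intro i
      exact abs_le.1 (hx i)
    · simp [cube]
  calc ∑' p, μ (nearCubes B k p ∩ U)
      ≤ ∑' p, ∑ e ∈ box, μ (cube B k (p + e) ∩ U) :=
        ENNReal.tsum_le_tsum fun p =>
          (measure_mono (hsub p)).trans (measure_biUnion_finset_le _ _)
    _ = ∑ e ∈ box, ∑' p, μ (cube B k (p + e) ∩ U) :=
        Summable.tsum_finsetSum fun _ _ => ENNReal.summable
    _ ≤ ∑ _e ∈ box, μ U := by
        refine Finset.sum_le_sum fun e _ => ?_
        refine ((Equiv.addRight e).tsum_eq (fun q => μ (cube B k q ∩ U))).trans_le ?_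
        exact tsum_measure_cube_inter_le μ B k hU
    _ = _ := by rw [Finset.sum_const, hcard, nsmul_eq_mul]

/-! ### Light cubes -/

/-- A cube of generation `k + 1` is light if its mass in `K` is small compared with the mass
of the neighbourhood of its parent. -/
def lightCubes {n : ℕ} (μ : Measure (Rn n)) (K : Set (Rn n)) (c : ℝ≥0∞) (B k : ℕ) :
    Set (Fin n → ℤ) :=
  {q | ∀ p, q ∈ childIndices B p → μ (cube B (k + 1) q ∩ K) ≤ c * μ (nearCubes B k p)}

/-- The part of `K` covered by light cubes of one generation has small measure. -/
theorem measure_lightCubes_le {n : ℕ} (μ : Measure (Rn n)) {K U : Set (Rn n)}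
    (hU : MeasurableSet U) (c : ℝ≥0∞) {B k : ℕ} (hB : 0 < B)
    (hKU : ∀ x ∈ K, nearCubes B k (cubeIndex B k x) ⊆ U) :
    μ {x ∈ K | cubeIndex B (k + 1) x ∈ lightCubes μ K c B k} ≤
      (B ^ n : ℕ) * c * ((2 * n + 1) ^ n : ℕ) * μ U := by
  classical
  set E := {x ∈ K | cubeIndex B (k + 1) x ∈ lightCubes μ K c B k}
  have hsub : E ⊆ ⋃ p, E ∩ cube B k p := fun x hx => Set.mem_iUnion.2 ⟨cubeIndex B k x, hx, rfl⟩
  have key : ∀ p, μ (E ∩ cube B k p) ≤ (B ^ n : ℕ) * c * μ (nearCubes B k p ∩ U) := by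
    intro p
    rcases (E ∩ cube B k p).eq_empty_or_nonempty with h | ⟨x, hxE, hxp⟩
    · simp [h]
    have hpU : nearCubes B k p ∩ U = nearCubes B k p := by
      rw [Set.inter_eq_left]
      have := hKU x hxE.1
      rwa [show cubeIndex B k x = p from hxp] at this
    rw [hpU]
    set L := (childIndices B p).filter (· ∈ lightCubes μ K c B k)
    have hsub' : E ∩ cube B k p ⊆ ⋃ q ∈ L, cube B (k + 1) q ∩ K := by
      rintro y ⟨hyE, hyp⟩
      simp only [Set.mem_iUnion]
      refine ⟨cubeIndex B (k + 1) y, Finset.mem_filter.2 ⟨?_, hyE.2⟩, rfl, hyE.1⟩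
      have := cubeIndex_succ_mem_childIndices hB k y
      rwa [show cubeIndex B k y = p from hyp] at this
    calc μ (E ∩ cube B k p) ≤ ∑ q ∈ L, μ (cube B (k + 1) q ∩ K) :=
          (measure_mono hsub').trans (measure_biUnion_finset_le _ _)
      _ ≤ ∑ _q ∈ L, c * μ (nearCubes B k p) := by
          refine Finset.sum_le_sum fun q hq => ?_
          exact (Finset.mem_filter.1 hq).2 p (Finset.mem_filter.1 hq).1
      _ = L.card * (c * μ (nearCubes B k p)) := by rw [Finset.sum_const, nsmul_eq_mul]
      _ ≤ (B ^ n : ℕ) * (c * μ (nearCubes B k p)) := by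
          gcongr
          exact (Finset.card_filter_le _ _).trans (card_childIndices B p).le
      _ = _ := by ring
  calc μ E ≤ ∑' p, μ (E ∩ cube B k p) := (measure_mono hsub).trans (measure_iUnion_le _)
    _ ≤ ∑' p, (B ^ n : ℕ) * c * μ (nearCubes B k p ∩ U) := ENNReal.tsum_le_tsum key
    _ = (B ^ n : ℕ) * c * ∑' p, μ (nearCubes B k p ∩ U) := ENNReal.tsum_mul_left
    _ ≤ (B ^ n : ℕ) * c * (((2 * n + 1) ^ n : ℕ) * μ U) := by
        gcongr
        exact measure_nearCubes_inter_le μ B k hU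
    _ = _ := by ring

/-! ### Thin cones and the number of heavy children -/

/-- The points `x` for which some cone of radius `r` with a half-space removed carries at most the
proportion `c` of the mass of the ball. -/
def IsThinAt {n : ℕ} (μ : Measure (Rn n)) (m : ℕ) (α : ℝ) (c : ℝ≥0∞) (r : ℝ) (x : Rn n) : Prop :=
  ∃ θ ∈ unitSphere n, ∃ V ∈ grassmannian n (n - m),
    μ (truncCone x r V α \ H x θ α) ≤ c * μ (Metric.closedBall x r)

/-- An `(n - m)`-plane is cut out by `m` unit vectors which control the distance to it. -/
theorem exists_unit_normals {n m : ℕ} (hm : m ≤ n) {V : Submodule ℝ (Rn n)}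
    (hV : V ∈ grassmannian n (n - m)) :
    ∃ v : Fin m → Rn n, (∀ i, ‖v i‖ = 1) ∧
      ∀ w, Metric.infDist w (V : Set (Rn n)) ≤ ∑ i, |inner ℝ w (v i)| := by
  have hV' : Module.finrank ℝ V = n - m := hV
  have h1 : Module.finrank ℝ Vᗮ = m := by
    have := V.finrank_add_finrank_orthogonal
    rw [hV', finrank_euclideanSpace_fin] at this
    omega
  let b := (stdOrthonormalBasis ℝ Vᗮ).reindex (finCongr h1)
  refine ⟨fun i => (b i : Rn n), fun i => b.orthonormal.1 i, fun w => ?_⟩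
  have h2 : Metric.infDist w (V : Set (Rn n)) ≤ ‖w - V.starProjection w‖ := by
    rw [← dist_eq_norm]
    exact Metric.infDist_le_dist_of_mem (V.starProjection_apply_mem w)
  refine h2.trans ?_
  have h3 : w - V.starProjection w = (Vᗮ.orthogonalProjectionOnto w : Rn n) := by
    rw [← Submodule.starProjection_orthogonal_val]
    rfl
  rw [h3, Submodule.norm_coe, ← b.sum_repr (Vᗮ.orthogonalProjectionOnto w)]
  refine (norm_sum_le _ _).trans (Finset.sum_le_sum fun i _ => ?_)
  rw [norm_smul, b.orthonormal.1 i, mul_one, b.repr_apply_apply, Real.norm_eq_abs,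
    real_inner_comm]
  refine (congrArg _ ?_).le
  exact Submodule.inner_orthogonalProjectionOnto_eq_of_mem_right (b i) w

/-- If `y' - y` is almost orthogonal to approximate normals of `V`, then the points close to `y'` and
far from `y` lie in the cone around `V` at `y`. -/
theorem mem_cone_of_approx {n m : ℕ} {V : Submodule ℝ (Rn n)} {v τ : Fin m → Rn n}
    {α ε h L : ℝ} (hε : 0 < ε) (hα : 4 * (m + 1) * ε ≤ α)  (h0 : 0 < h)
    (hL : n + 1 ≤ ε * L)
    (hv : ∀ w, Metric.infDist w (V : Set (Rn n)) ≤ ∑ i, |inner ℝ w (v i)|)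
    (hτ : ∀ i, ‖v i - τ i‖ ≤ ε) (hτ' : ∀ i, ‖τ i‖ ≤ 1) {y y' z : Rn n}
    (hyy : ∀ i, |inner ℝ (y' - y) (τ i)| ≤ h) (hz : ‖z - y'‖ ≤ n * h)
    (hzy : L * h ≤ ‖z - y‖) : z ∈ cone y V α := by
  have hL0 : 0 < L := by
    have : (0 : ℝ) < ε * L := lt_of_lt_of_le (by positivity) hL
    exact (pos_iff_pos_of_mul_pos this).1 hε
  have hpos : 0 < ‖z - y‖ := (by positivity : 0 < L * h).trans_le hzy
  -- The errors from `z - y'` and `y' - y` total at most `(n + 1) h`, so separation by `L * h` makes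
  -- them at most `ε ‖z - y‖`.
  have hb : (n + 1) * h ≤ ε * ‖z - y‖ :=
    calc (n + 1) * h ≤ (ε * L) * h := by gcongr
      _ = ε * (L * h) := by ring
      _ ≤ _ := by gcongr
  have key : ∀ i, |inner ℝ (z - y) (v i)| ≤ 2 * ε * ‖z - y‖ := by
    intro i
    have e : inner ℝ (z - y) (v i) = inner ℝ (z - y) (v i - τ i) + inner ℝ (z - y') (τ i)
        + inner ℝ (y' - y) (τ i) := by
      rw [add_assoc, ← inner_add_left, sub_add_sub_cancel, ← inner_add_right, sub_add_cancel]
    have e1 : |inner ℝ (z - y) (v i - τ i)| ≤ ‖z - y‖ * ε :=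
      (abs_real_inner_le_norm _ _).trans (by gcongr; exact hτ i)
    have e2 : |inner ℝ (z - y') (τ i)| ≤ (n * h) * 1 :=
      (abs_real_inner_le_norm _ _).trans (by gcongr; exact hτ' i)
    rw [e]
    refine (abs_add_three _ _ _).trans ?_
    linarith [hyy i]
  refine (hv _).trans_lt ?_
  calc ∑ i, |inner ℝ (z - y) (v i)| ≤ ∑ _i : Fin m, 2 * ε * ‖z - y‖ :=
        Finset.sum_le_sum fun i _ => key i
    _ = (m * (2 * ε)) * ‖z - y‖ := by simp; ring
    _ < α * ‖z - y‖ := by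
        gcongr
        nlinarith [(Nat.cast_nonneg m : (0 : ℝ) ≤ m)]

/-- If a point close to `y'` and far from `y` lies in the cone `H y θ α`, then `y' - y` has a positive
component in each direction close to `θ`. -/
theorem inner_pos_of_mem_H {n : ℕ} {θ τ : Rn n} {α ε h L : ℝ} (hε : 0 < ε) (hα : 4 * ε ≤ α)
    (h0 : 0 < h) (hL : n + 1 ≤ ε * L) (hτ : ‖θ - τ‖ ≤ ε) (hτ' : ‖τ‖ ≤ 1) {y y' z : Rn n}
    (hz : ‖z - y'‖ ≤ n * h) (hzy : L * h ≤ ‖z - y‖) (hH : z ∈ H y θ α) :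
    0 < inner ℝ (y' - y) τ := by
  have hb : (n + 1) * h ≤ ε * ‖z - y‖ :=
    calc (n + 1) * h ≤ (ε * L) * h := by gcongr
      _ = ε * (L * h) := by ring
      _ ≤ _ := by gcongr
  have e : inner ℝ (z - y) θ = inner ℝ (z - y) (θ - τ) + inner ℝ (z - y') τ
      + inner ℝ (y' - y) τ := by
    rw [add_assoc, ← inner_add_left, sub_add_sub_cancel, ← inner_add_right, sub_add_cancel]
  have e1 : inner ℝ (z - y) (θ - τ) ≤ ‖z - y‖ * ε :=
    (real_inner_le_norm _ _).trans (by gcongr)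
  have e2 : inner ℝ (z - y') τ ≤ (n * h) * 1 :=
    (real_inner_le_norm _ _).trans (by gcongr)
  have hH' : α * ‖z - y‖ < inner ℝ (z - y) θ := hH
  have hα' : 4 * ε * ‖z - y‖ ≤ α * ‖z - y‖ := by gcongr
  have hnh : 0 ≤ n * h := by positivity
  linarith

/-- Distinct cubes with congruent indices are far apart. -/
theorem mul_le_norm_sub_of_modEq {n B k : ℕ} (hB : 0 < B) {L : ℕ} {q q' : Fin n → ℤ}
    (hne : q ≠ q') (hmod : ∀ i, (q i : ZMod (L + 1)) = q' i) {y z : Rn n}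
    (hy : y ∈ cube B k q) (hz : z ∈ cube B k q') : L * ((B : ℝ) ^ k)⁻¹ ≤ ‖z - y‖ := by
  have hB' : (0 : ℝ) < (B : ℝ) ^ k := by positivity
  obtain ⟨i, hi⟩ := Function.ne_iff.1 hne
  refine le_trans ?_ (abs_apply_le_norm (z - y) i)
  rw [← div_eq_mul_inv, div_le_iff₀ hB']
  refine le_of_le_of_eq ?_ (congrArg (_ * ·) (abs_of_pos hB'))
  rw [← abs_mul]
  simp only [PiLp.sub_apply, sub_mul]
  have hdvd : ((L + 1 : ℕ) : ℤ) ∣ q' i - q i :=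
    (ZMod.intCast_eq_intCast_iff_dvd_sub _ _ _).1 (hmod i)
  have hle : ((L + 1 : ℕ) : ℤ) ≤ |q' i - q i| :=
    Int.le_of_dvd (abs_pos.2 (sub_ne_zero.2 (Ne.symm hi))) ((dvd_abs _ _).2 hdvd)
  have hle' : (L : ℝ) + 1 ≤ |(q' i : ℝ) - q i| := by exact_mod_cast hle
  have hyi : ⌊y i * (B : ℝ) ^ k⌋ = q i := congrFun hy i
  have hzi : ⌊z i * (B : ℝ) ^ k⌋ = q' i := congrFun hz i
  rw [Int.floor_eq_iff] at hyi hzi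
  rcases le_abs.1 hle' with h | h
  · exact (by linarith : (L : ℝ) ≤ _).trans (le_abs_self _)
  · exact (by linarith : (L : ℝ) ≤ _).trans (neg_le_abs _)

/-- Unit vectors are approximated by a finite set. -/
theorem exists_finite_net (n : ℕ) {ε : ℝ} (hε : 0 < ε) :
    ∃ T : Finset (Rn n), (∀ τ ∈ T, ‖τ‖ ≤ 1) ∧ ∀ v : Rn n, ‖v‖ = 1 → ∃ τ ∈ T, ‖v - τ‖ ≤ ε := by
  obtain ⟨t, hts, htf, hcov⟩ := (isCompact_sphere (0 : Rn n) 1).finite_cover_balls hε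
  refine ⟨htf.toFinset, fun τ hτ => ?_, fun v hv => ?_⟩
  · have := hts (htf.mem_toFinset.1 hτ)
    simpa using (mem_sphere_zero_iff_norm.1 this).le
  · have := hcov (mem_sphere_zero_iff_norm.2 hv)
    simp only [Set.mem_iUnion, Metric.mem_ball, dist_eq_norm] at this
    obtain ⟨τ, hτ, h⟩ := this
    exact ⟨τ, htf.mem_toFinset.2 hτ, h.le⟩

/-- If the measure is thin at scale `n B⁻ᵏ` at the points of `S`, then each cube of generation `k` has
at most a constant times `Bᵐ` children which are not light. The points of `S` in these children are
coloured by their approximate directions and approximate coordinates along the normals; the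
colouring is injective because of two cubes of the same colour, each would lie in the half-space
of the other. -/
theorem exists_card_heavy_children_le (n m : ℕ) (hm : m < n) {α : ℝ} (hα : 0 < α) :
    ∃ C₀ : ℕ, 1 ≤ C₀ ∧ ∀ (μ : Measure (Rn n)) (K S : Set (Rn n)) (c : ℝ≥0∞) (B k : ℕ), 0 < B →
      (∀ A, MeasurableSet A → 0 < μ (A ∩ K) → (A ∩ S).Nonempty) →
      (∀ x ∈ S, IsThinAt μ m α c (n * ((B : ℝ) ^ k)⁻¹) x) →
      ∀ p, ∃ G : Finset (Fin n → ℤ), G.card ≤ C₀ * B ^ m ∧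
        ∀ q ∈ childIndices B p, q ∉ lightCubes μ K c B k → q ∈ G := by
  classical
  set ε : ℝ := α / (4 * (m + 1)) with hε_def
  have hε : 0 < ε := by positivity
  have hεα : 4 * (m + 1) * ε ≤ α := by rw [hε_def]; field_simp; rfl
  have hεα' : 4 * ε ≤ α := by
    refine le_trans ?_ hεα
    nlinarith [(Nat.cast_nonneg m : (0 : ℝ) ≤ m)]
  obtain ⟨L, hL⟩ := exists_nat_ge ((n + 1) / ε)
  have hL' : (n : ℝ) + 1 ≤ ε * L := by rwa [div_le_iff₀' hε] at hL
  obtain ⟨T, hT1, hTnet⟩ := exists_finite_net n hε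
  -- The factors count half-space directions, tuples of normals, residues modulo `L + 1`, and what
  -- remains of the number of buckets once `Bᵐ` is taken out.
  have : ∃ C₀ : ℕ, C₀ = T.card * T.card ^ m * (L + 1) ^ n * (2 * n + 1) ^ m := ⟨_, rfl⟩
  obtain ⟨C₀, hC₀⟩ := this
  refine ⟨C₀ + 1, by omega, fun μ K S c B k hB hKS hS p => ?_⟩
  refine ⟨(childIndices B p).filter (· ∉ lightCubes μ K c B k), ?_, fun q hq hq' =>
    Finset.mem_filter.2 ⟨hq, hq'⟩⟩
  set G := (childIndices B p).filter (· ∉ lightCubes μ K c B k) with hG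
  set h : ℝ := ((B : ℝ) ^ (k + 1))⁻¹ with hh
  have h0 : 0 < h := by positivity
  have hhB : n * ((B : ℝ) ^ k)⁻¹ = n * (B * h) := by
    rw [hh, pow_succ]; field_simp
  -- Parents are unique, so the quantifier over parents in `lightCubes` concerns `p` alone.
  have hpar : ∀ q ∈ G, ∀ p', q ∈ childIndices B p' → p' = p := fun q hq p' hp' => funext fun i =>
    ((mem_childIndices hB).1 hp' i).symm.trans
      ((mem_childIndices hB).1 (Finset.mem_filter.1 hq).1 i)
  have hheavy : ∀ q ∈ G, c * μ (nearCubes B k p) < μ (cube B (k + 1) q ∩ K) := by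
    intro q hq
    by_contra hcon
    refine (Finset.mem_filter.1 hq).2 fun p' hp' => ?_
    rw [hpar q hq p' hp']
    exact not_lt.1 hcon
  have hdata : ∀ q ∈ G, ∃ y ∈ cube B (k + 1) q, ∃ (θ : Rn n) (V : Submodule ℝ (Rn n)), ∃ v : Fin m → Rn n, ∃ t : Rn n,
      ∃ τ : Fin m → Rn n,
      (∀ w, Metric.infDist w (V : Set (Rn n)) ≤ ∑ i, |inner ℝ w (v i)|) ∧
      μ (truncCone y (n * ((B : ℝ) ^ k)⁻¹) V α \ H y θ α) ≤ c * μ (nearCubes B k p) ∧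
      t ∈ T ∧ ‖θ - t‖ ≤ ε ∧ (∀ i, τ i ∈ T) ∧ ∀ i, ‖v i - τ i‖ ≤ ε := by
    intro q hq
    obtain ⟨y, hy, hyS⟩ := hKS _ (measurableSet_cube B (k + 1) q) (pos_of_gt (hheavy q hq))
    obtain ⟨θ, hθ, V, hV, hthin⟩ := hS y hyS
    obtain ⟨v, hv1, hv⟩ := exists_unit_normals hm.le hV
    obtain ⟨t, htT, ht⟩ := hTnet θ (mem_sphere_zero_iff_norm.1 hθ)
    choose τ hτT hτ using fun i => hTnet (v i) (hv1 i)
    refine ⟨y, hy, θ, V, v, t, τ, hv, hthin.trans ?_, htT, ht, hτT, hτ⟩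
    have hyp : cubeIndex B k y = p :=
      cube_subset_of_mem_childIndices hB (Finset.mem_filter.1 hq).1 hy
    gcongr
    rw [← hyp]
    exact closedBall_subset_nearCubes hB y
  rcases G.eq_empty_or_nonempty with hGe | ⟨q₀, hq₀⟩
  · simp [hGe]
  choose! y hy θ V v t τ hv hthin htT ht hτT hτ using hdata
  have hyp : ∀ q ∈ G, y q ∈ cube B k p := fun q hq =>
    cube_subset_of_mem_childIndices hB (Finset.mem_filter.1 hq).1 (hy q hq)
  -- Coordinates along the normals are recorded to precision `h`, relative to one reference point.
  -- They range over `2nB + 1` values each, which is the source of `Bᵐ`. The normals depend on `q`,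
  -- so buckets are compared only for equal `τ`.
  set bucket : (Fin n → ℤ) → Fin m → ℤ := fun q i => ⌊inner ℝ (y q - y q₀) (τ q i) / h⌋
  set colour : (Fin n → ℤ) → ((Rn n × (Fin m → Rn n)) × (Fin n → ZMod (L + 1))) × (Fin m → ℤ) :=
    fun q => (((t q, τ q), fun i => (q i : ZMod (L + 1))), bucket q)
  set target : Finset (((Rn n × (Fin m → Rn n)) × (Fin n → ZMod (L + 1))) × (Fin m → ℤ)) :=
    ((T ×ˢ Fintype.piFinset fun _ => T) ×ˢ Finset.univ) ×ˢ
      Fintype.piFinset fun _ => Finset.Icc (-(n * B : ℕ) : ℤ) (n * B : ℕ)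
  have htarget : target.card ≤ (C₀ + 1) * B ^ m := by
    have e : target.card = T.card * T.card ^ m * (L + 1) ^ n * (2 * (n * B) + 1) ^ m := by
      simp only [target, Finset.card_product, Fintype.card_piFinset, Finset.prod_const,
        Finset.card_univ, Fintype.card_fin, Fintype.card_pi, ZMod.card, Int.card_Icc]
      congr 2
      omega
    rw [e]
    calc T.card * T.card ^ m * (L + 1) ^ n * (2 * (n * B) + 1) ^ m
        ≤ T.card * T.card ^ m * (L + 1) ^ n * ((2 * n + 1) * B) ^ m := by
          gcongr
          nlinarith
      _ = C₀ * B ^ m := by rw [hC₀, mul_pow]; ring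
      _ ≤ (C₀ + 1) * B ^ m := by gcongr; omega
  refine (Finset.card_le_card_of_injOn colour ?_ ?_).trans htarget
  · intro q hq
    have hq' : q ∈ G := hq
    simp only [target, colour, Finset.coe_product, Set.mem_prod, Finset.mem_coe,
      Fintype.mem_piFinset, Finset.mem_univ, and_true]
    refine ⟨⟨htT q hq', hτT q hq'⟩, fun i => ?_⟩
    have h1 : ‖y q - y q₀‖ ≤ n * (B * h) := by
      rw [← hhB]
      exact norm_sub_le_of_mem_cube hB (hyp q hq') (hyp q₀ hq₀)
    have h2 : |inner ℝ (y q - y q₀) (τ q i)| ≤ (n * (B * h)) * 1 :=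
      (abs_real_inner_le_norm _ _).trans (by gcongr; exact hT1 _ (hτT q hq' i))
    have h3 : |inner ℝ (y q - y q₀) (τ q i) / h| ≤ (n * B : ℕ) := by
      rw [abs_div, abs_of_pos h0, div_le_iff₀ h0]
      push_cast
      linarith
    rw [abs_le] at h3
    rw [Finset.mem_Icc]
    refine ⟨Int.le_floor.2 (by push_cast at h3 ⊢; exact h3.1), ?_⟩
    exact Int.floor_le_iff.2 (by push_cast at h3 ⊢; linarith)
  · intro q hq q' hq' hcol
    have hq1 : q ∈ G := hq
    have hq2 : q' ∈ G := hq'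
    by_contra hne
    simp only [colour, Prod.mk.injEq] at hcol
    obtain ⟨⟨⟨hct, hcτ⟩, hcmod⟩, hcb⟩ := hcol
    have step : ∀ a ∈ G, ∀ b ∈ G, a ≠ b → t a = t b → τ a = τ b →
        (fun i => (a i : ZMod (L + 1))) = (fun i => (b i : ZMod (L + 1))) →
        bucket a = bucket b → 0 < inner ℝ (y b - y a) (t a) := by
      intro a ha b hb hab hct hcτ hmod hbu
      -- The cube `b` has more mass than the cone at `y a` minus its half-space, so it has a point
      -- `z` outside that set. The colour puts `z` in the cone, hence `z` lies in the half-space.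
      have hlt := (hthin a ha).trans_lt (hheavy b hb)
      have : ¬ cube B (k + 1) b ⊆ truncCone (y a) (n * ((B : ℝ) ^ k)⁻¹) (V a) α \
          H (y a) (θ a) α := by
        intro hsub
        exact (hlt.trans_le (measure_mono (Set.inter_subset_left.trans hsub))).false
      obtain ⟨z, hz, hz'⟩ := Set.not_subset.1 this
      have hzb : ‖z - y b‖ ≤ n * h := norm_sub_le_of_mem_cube hB hz (hy b hb)
      have hza : L * h ≤ ‖z - y a‖ :=
        mul_le_norm_sub_of_modEq hB hab (fun i => congrFun hmod i) (hy a ha) hz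
      have hzcone : z ∈ cone (y a) (V a) α := by
        refine mem_cone_of_approx hε hεα h0 hL' (hv a ha) (hτ a ha)
          (fun i => hT1 _ (hτT a ha i)) (fun i => ?_) hzb hza
        have h1 := (Int.abs_sub_lt_one_of_floor_eq_floor (congrFun hbu.symm i)).le
        rw [hcτ, ← sub_div, ← inner_sub_left, sub_sub_sub_cancel_right, abs_div, abs_of_pos h0,
          div_le_one h0] at h1
        rw [hcτ]
        exact h1
      have hzball : z ∈ Metric.closedBall (y a) (n * ((B : ℝ) ^ k)⁻¹) := by
        rw [mem_closedBall_iff_norm]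
        exact norm_sub_le_of_mem_cube hB
          (cube_subset_of_mem_childIndices hB (Finset.mem_filter.1 hb).1 hz) (hyp a ha)
      have hzH : z ∈ H (y a) (θ a) α := by
        by_contra hcon
        exact hz' ⟨⟨hzball, hzcone⟩, hcon⟩
      exact inner_pos_of_mem_H hε hεα' h0 hL' (ht a ha) (hT1 _ (htT a ha)) hzb hza hzH
    have i1 := step q hq1 q' hq2 hne hct hcτ hcmod hcb
    have i2 := step q' hq2 q hq1 (Ne.symm hne) hct.symm hcτ.symm hcmod.symm hcb.symm
    rw [← hct, ← neg_sub (y q') (y q), inner_neg_left] at i2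
    linarith

/-! ### Limsup sets, Markov's inequality and Hausdorff measure -/

/-- Continuity from above along the decreasing tail unions, each of which contains some `P l`;
finiteness of `μ` is essential. -/
theorem le_measure_limsup {X : Type*} [MeasurableSpace X] (μ : Measure X) [IsFiniteMeasure μ]
    {P : ℕ → Set X} (hP : ∀ l, MeasurableSet (P l)) {a : ℝ≥0∞} (ha : ∀ l, a ≤ μ (P l)) :
    a ≤ μ (limsup P atTop) := by
  rw [limsup_eq_iInf_iSup_of_nat]
  simp only [Set.iSup_eq_iUnion, Set.iInf_eq_iInter]
  have hanti : Antitone fun i => ⋃ l, ⋃ (_ : l ≥ i), P l := by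
    intro i j hij x hx
    simp only [Set.mem_iUnion] at hx ⊢
    obtain ⟨l, hl, h⟩ := hx
    exact ⟨l, hij.trans hl, h⟩
  rw [hanti.measure_iInter
    (fun i => (MeasurableSet.iUnion fun l => MeasurableSet.iUnion fun _ => hP l).nullMeasurableSet)
    ⟨0, measure_ne_top μ _⟩]
  refine le_iInf fun i => (ha i).trans (measure_mono ?_)
  exact Set.subset_iUnion₂_of_subset i le_rfl subset_rfl

/-- Markov's inequality for the number of sets in a finite family to which a point belongs. -/
theorem mul_measure_le_sum_measure {X : Type*} [MeasurableSpace X] (μ : Measure X)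
    {E : ℕ → Set X} (hE : ∀ j, MeasurableSet (E j)) (J b : ℕ) :
    (b : ℝ≥0∞) * μ {x | b ≤ ∑ j ∈ Finset.range J, (E j).indicator (fun _ => (1 : ℕ)) x} ≤
      ∑ j ∈ Finset.range J, μ (E j) := by
  have hm : Measurable fun x => ∑ j ∈ Finset.range J, (E j).indicator (fun _ => (1 : ℝ≥0∞)) x :=
    Finset.measurable_fun_sum _ fun j _ => measurable_const.indicator (hE j)
  have h := mul_meas_ge_le_lintegral (μ := μ) hm b
  rw [lintegral_finsetSum _ fun j _ => measurable_const.indicator (hE j)] at h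
  simp only [lintegral_indicator_const (hE _), one_mul] at h
  refine le_trans ?_ h
  gcongr with x
  intro hx
  have e : ((∑ j ∈ Finset.range J, (E j).indicator (fun _ => (1 : ℕ)) x : ℕ) : ℝ≥0∞) =
      ∑ j ∈ Finset.range J, (E j).indicator (fun _ => (1 : ℝ≥0∞)) x := by
    rw [Nat.cast_sum]
    refine Finset.sum_congr rfl fun j _ => ?_
    by_cases hx : x ∈ E j <;> simp [hx]
  rw [← e]
  exact_mod_cast hx

/-- A limsup of finite unions of sets, with few and small sets in each union, is null for the
Hausdorff measure. -/
theorem hausdorffMeasure_eq_zero_of_limsup {X ι : Type*} [EMetricSpace X] [MeasurableSpace X]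
    [BorelSpace X] {d : ℝ} (hd : 0 < d) (F : ℕ → Finset ι) (t : ℕ → ι → Set X)
    {A ρ a b : ℝ≥0∞} (ha : a ≠ ⊤) (hb : b ≠ ⊤) (hρ : ρ < 1) (hA : A * ρ ^ d < 1)
    (hF : ∀ l, ((F l).card : ℝ≥0∞) ≤ a * A ^ l) (ht : ∀ l q, Metric.ediam (t l q) ≤ b * ρ ^ l)
    {Z : Set X} (hZ : ∀ x ∈ Z, ∃ᶠ l in atTop, ∃ q ∈ F l, x ∈ t l q) : μH[d] Z = 0 := by
  set κ := A * ρ ^ d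
  have hsum : ∀ n, ∑' i : (Σ l : ℕ, (F (n + l))), Metric.ediam (t (n + i.1) i.2) ^ d ≤
      a * b ^ d * (1 - κ)⁻¹ * κ ^ n := by
    intro n
    rw [ENNReal.tsum_sigma fun l (q : F (n + l)) => Metric.ediam (t (n + l) q) ^ d]
    calc ∑' l, ∑' q : (F (n + l)), Metric.ediam (t (n + l) q) ^ d
        ≤ ∑' l, a * b ^ d * κ ^ n * κ ^ l := by
          refine ENNReal.tsum_le_tsum fun l => ?_
          rw [tsum_fintype]
          calc ∑ q : (F (n + l)), Metric.ediam (t (n + l) q) ^ d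
              ≤ ∑ _q : (F (n + l)), (b * ρ ^ (n + l)) ^ d := by
                gcongr with q _
                exact ht _ _
            _ = (F (n + l)).card * (b * ρ ^ (n + l)) ^ d := by simp
            _ ≤ (a * A ^ (n + l)) * (b * ρ ^ (n + l)) ^ d := by gcongr; exact hF _
            _ = a * b ^ d * κ ^ n * κ ^ l := by
                rw [ENNReal.mul_rpow_of_nonneg _ _ hd.le, ← ENNReal.rpow_natCast, ← ENNReal.rpow_natCast ρ,
                  ← ENNReal.rpow_mul, mul_comm _ d, ENNReal.rpow_mul, ENNReal.rpow_natCast,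
                  ENNReal.rpow_natCast, mul_assoc _ (κ ^ n), ← pow_add, mul_pow]
                ring
      _ = a * b ^ d * (1 - κ)⁻¹ * κ ^ n := by
          rw [ENNReal.tsum_mul_left, ENNReal.tsum_geometric]; ring
  have hlim : Tendsto (fun n => a * b ^ d * (1 - κ)⁻¹ * κ ^ n) atTop (𝓝 0) := by
    rw [← mul_zero (a * b ^ d * (1 - κ)⁻¹)]
    refine ENNReal.Tendsto.const_mul (ENNReal.tendsto_pow_atTop_nhds_zero_of_lt_one hA) (Or.inr ?_)
    refine ENNReal.mul_ne_top (ENNReal.mul_ne_top ha (ENNReal.rpow_ne_top_of_nonneg hd.le hb)) ?_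
    exact ENNReal.inv_ne_top.2 (tsub_pos_of_lt hA).ne'
  have hlim' : Tendsto (fun n => b * ρ ^ n) atTop (𝓝 0) := by
    rw [← mul_zero b]
    exact ENNReal.Tendsto.const_mul (ENNReal.tendsto_pow_atTop_nhds_zero_of_lt_one hρ) (Or.inr hb)
  -- For each `n`, the sets of all levels from `n` on cover `Z`; the sums are tails of a geometric
  -- series of ratio `κ`.
  have h := Measure.hausdorffMeasure_le_liminf_tsum d Z (l := atTop) (fun n => b * ρ ^ n) hlim'
    (ι := fun n : ℕ => (Σ l : ℕ, (F (n + l)))) (fun n i => t (n + i.1) i.2)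
    (Eventually.of_forall fun n i => (ht _ _).trans (by
      gcongr b * ?_
      exact pow_le_pow_right_of_le_one' hρ.le (Nat.le_add_right n i.1)))
    (Eventually.of_forall fun n x hx => by
      obtain ⟨l, hl, q, hq, hxq⟩ := frequently_atTop.1 (hZ x hx) n
      obtain ⟨j, rfl⟩ := Nat.exists_eq_add_of_le hl
      exact Set.mem_iUnion.2 ⟨⟨j, q, hq⟩, hxq⟩)
  refine le_antisymm (h.trans ?_) zero_le
  refine (liminf_le_liminf (Eventually.of_forall hsum)).trans ?_
  exact hlim.liminf_eq.le

/-! ### The dimension bound -/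

/-- A measure which is thin at all small scales on a set of positive measure has small
Hausdorff dimension. -/
theorem exists_hausdorffDim_le_of_isThinAt (n m : ℕ) (hm : m < n) {α : ℝ} (hα : 0 < α) {d : NNReal}
    (hd : (m : ℝ) < d) :
    ∃ c : ℝ≥0∞, 0 < c ∧ c ≠ ⊤ ∧ ∀ (μ : Measure (Rn n)) [IsFiniteMeasure μ] (S : Set (Rn n))
      (r₀ : ℝ), 0 < r₀ → μ S ≠ 0 → (∀ x ∈ S, ∀ r, 0 < r → r < r₀ → IsThinAt μ m α c r x) →
      hausdorffDim μ ≤ d := by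
  classical
  obtain ⟨C₀, hC₀, hbranch⟩ := exists_card_heavy_children_le n m hm hα
  -- This gives `m D + n + 1 < D d`: the spare power of `B` will absorb `(2 C₀)ᴰ`. Since `C₀` does
  -- not depend on `B`, the latter can be chosen after `D`.
  obtain ⟨D, hD⟩ := exists_nat_gt ((n + 1) / ((d : ℝ) - m))
  have hdm : (0 : ℝ) < d - m := sub_pos.2 hd
  have hd0 : (0 : ℝ) < d := (Nat.cast_nonneg m).trans_lt hd
  have hD0 : 0 < D := by
    have : (0 : ℝ) < D := lt_trans (by positivity) hD
    exact_mod_cast this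
  rw [div_lt_iff₀ hdm] at hD
  obtain ⟨B, hBdef⟩ : ∃ B, B = (2 * C₀) ^ D + 1 := ⟨_, rfl⟩
  have hB2 : 1 < B := by
    have : 0 < (2 * C₀) ^ D := by positivity
    omega
  have hB : 0 < B := by omega
  set N := C₀ * B ^ m with hN
  have hN1 : 1 ≤ N := Nat.mul_pos hC₀ (by positivity)
  have hBr : (1 : ℝ) < B := by exact_mod_cast hB2
  have hrate : (((2 * N) ^ D * B ^ n : ℕ) : ℝ≥0∞) * ((((B : ℝ≥0∞) ^ D)⁻¹) ^ (d : ℝ)) < 1 := by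
    have hlt : (((2 * N) ^ D * B ^ n : ℕ) : ℝ) < ((B : ℝ) ^ D) ^ (d : ℝ) := by
      have e1 : (2 * N) ^ D * B ^ n < B ^ (m * D + n + 1) := by
        calc (2 * N) ^ D * B ^ n = (2 * C₀) ^ D * B ^ (m * D + n) := by
              rw [hN, ← mul_assoc, mul_pow, ← pow_mul]; ring
          _ < B * B ^ (m * D + n) := by gcongr; omega
          _ = _ := by ring
      calc (((2 * N) ^ D * B ^ n : ℕ) : ℝ) < ((B ^ (m * D + n + 1) : ℕ) : ℝ) := by
            exact_mod_cast e1
        _ = (B : ℝ) ^ ((m * D + n + 1 : ℕ) : ℝ) := by rw [Real.rpow_natCast]; push_cast; rfl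
        _ ≤ (B : ℝ) ^ ((D : ℝ) * d) := by
            gcongr
            · exact hBr.le
            · push_cast; linarith
        _ = _ := by rw [Real.rpow_mul (by positivity), Real.rpow_natCast]
    have hlt' : (((2 * N) ^ D * B ^ n : ℕ) : ℝ≥0∞) < ((B : ℝ≥0∞) ^ D) ^ (d : ℝ) := by
      have := (ENNReal.ofReal_lt_ofReal_iff (by positivity)).2 hlt
      rwa [ENNReal.ofReal_natCast, ← ENNReal.ofReal_rpow_of_nonneg (by positivity) hd0.le,
        ENNReal.ofReal_pow (by positivity), ENNReal.ofReal_natCast] at this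
    rw [ENNReal.inv_rpow, ← div_eq_mul_inv]
    refine (ENNReal.div_lt_iff (Or.inl ?_) (Or.inl ?_)).2 (by rwa [one_mul])
    · exact (pos_of_gt hlt').ne'
    · exact ENNReal.rpow_ne_top_of_nonneg hd0.le (by finiteness)
  -- With `c = Q⁻¹` and `μ U ≤ 2 μ K`, the light cubes of one generation carry at most `μ K / (2
  -- D)`.
  set Q : ℕ := 4 * D * B ^ n * (2 * n + 1) ^ n with hQ
  have hQ0 : 0 < Q := by positivity
  refine ⟨(Q : ℝ≥0∞)⁻¹, ENNReal.inv_pos.2 (ENNReal.natCast_ne_top Q),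
    ENNReal.inv_ne_top.2 (by exact_mod_cast hQ0.ne'), fun μ _ S r₀ hr₀ hS hthin => ?_⟩
  set c : ℝ≥0∞ := (Q : ℝ≥0∞)⁻¹ with hc
  -- `S` need not be measurable, so `K` is taken inside its measurable hull. Measurable sets
  -- charging `K` still meet `S`, which is all that the count of heavy children needs.
  obtain ⟨K, hKS, hK, hK0⟩ := (measurableSet_toMeasurable μ S).exists_lt_isCompact_of_ne_top
    (measure_ne_top μ _) (r := 0) (by rwa [measure_toMeasurable, pos_iff_ne_zero])
  have hKS' : ∀ A, MeasurableSet A → 0 < μ (A ∩ K) → (A ∩ S).Nonempty := by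
    intro A hA h
    have h1 : 0 < μ (toMeasurable μ S ∩ A) :=
      h.trans_le (measure_mono fun x hx => ⟨hKS hx.2, hx.1⟩)
    rw [Measure.measure_toMeasurable_inter hA (measure_ne_top μ _)] at h1
    obtain ⟨x, hx⟩ := nonempty_of_measure_ne_zero h1.ne'
    exact ⟨x, hx.2, hx.1⟩
  -- Neighbourhoods of small cubes meeting `K` stay in this thickening, so their total mass is
  -- comparable to `μ K`.
  obtain ⟨δ, hδ, hδK⟩ : ∃ δ > 0, μ (Metric.cthickening δ K) < 2 * μ K := by
    have h1 := tendsto_measure_cthickening_of_isClosed (μ := μ) (s := K)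
      ⟨1, one_pos, measure_ne_top μ _⟩ hK.isClosed
    have h2 : μ K < 2 * μ K := by
      rw [two_mul]
      exact ENNReal.lt_add_right (measure_ne_top μ _) hK0.ne'
    have h3 := ((h1.eventually_lt_const h2).filter_mono nhdsWithin_le_nhds :
      ∀ᶠ δ in 𝓝[>] (0 : ℝ), _)
    obtain ⟨δ, h, h'⟩ := (h3.and self_mem_nhdsWithin).exists
    exact ⟨δ, h', h⟩
  set U := Metric.cthickening δ K with hU
  have hUm : MeasurableSet U := Metric.isClosed_cthickening.measurableSet
  have hlim : Tendsto (fun k : ℕ => ((B : ℝ) ^ k)⁻¹) atTop (𝓝 0) := by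
    simp only [← inv_pow]
    exact tendsto_pow_atTop_nhds_zero_of_lt_one (by positivity) (inv_lt_one_of_one_lt₀ hBr)
  have hev : ∀ᶠ k : ℕ in atTop, n * ((B : ℝ) ^ k)⁻¹ < r₀ ∧
      n * ((n + 1) * ((B : ℝ) ^ k)⁻¹) < δ := by
    refine Eventually.and ?_ ?_
    · have := hlim.const_mul (n : ℝ)
      rw [mul_zero] at this
      exact this.eventually_lt_const hr₀
    · have := (hlim.const_mul ((n : ℝ) + 1)).const_mul (n : ℝ)
      rw [mul_zero, mul_zero] at this
      exact this.eventually_lt_const hδ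
  obtain ⟨k₀, hk₀⟩ := eventually_atTop.1 hev
  have hn : 0 < n := by omega
  have hgood : ∀ j p, ∃ G : Finset (Fin n → ℤ), G.card ≤ N ∧
      ∀ q ∈ childIndices B p, q ∉ lightCubes μ K c B (k₀ + j) → q ∈ G := by
    intro j
    refine hbranch μ K S c B (k₀ + j) hB hKS' fun x hx => ?_
    exact hthin x hx _ (by positivity) (hk₀ _ (Nat.le_add_right _ _)).1
  have hlight : ∀ j, μ {x ∈ K | cubeIndex B (k₀ + j + 1) x ∈ lightCubes μ K c B (k₀ + j)} ≤
      (B ^ n : ℕ) * c * ((2 * n + 1) ^ n : ℕ) * μ U := by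
    intro j
    refine measure_lightCubes_le μ hUm c hB fun x hx => ?_
    refine (nearCubes_subset_closedBall hB x).trans ?_
    refine (Metric.closedBall_subset_closedBall (hk₀ _ (Nat.le_add_right k₀ j)).2.le).trans ?_
    exact Metric.closedBall_subset_cthickening hx δ
  obtain ⟨F₀, hF₀⟩ : ∃ F₀ : Finset (Fin n → ℤ), ∀ x ∈ K, cubeIndex B k₀ x ∈ F₀ := by
    obtain ⟨R, hR⟩ := hK.isBounded.exists_norm_le
    refine ⟨Fintype.piFinset fun _ => Finset.Icc ⌊-(R * (B : ℝ) ^ k₀)⌋ ⌊R * (B : ℝ) ^ k₀⌋,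
      fun x hx => ?_⟩
    rw [Fintype.mem_piFinset]
    intro i
    have h1 := abs_le.1 ((abs_apply_le_norm x i).trans (hR x hx))
    rw [Finset.mem_Icc]
    refine ⟨Int.floor_le_floor ?_, Int.floor_le_floor ?_⟩
    · rw [← neg_mul]; gcongr; exact h1.1
    · gcongr; exact h1.2
  have htree := fun l : ℕ => exists_card_le_of_few_bad_steps (childIndices B)
    (fun j => lightCubes μ K c B (k₀ + j)) hN1 (fun p => (card_childIndices B p).le) hgood F₀
    (D * l) l
  choose F hFcard hF using htree
  set E : ℕ → Set (Rn n) :=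
    fun j => {x ∈ K | cubeIndex B (k₀ + j + 1) x ∈ lightCubes μ K c B (k₀ + j)} with hE
  have hEm : ∀ j, MeasurableSet (E j) := fun j =>
    hK.measurableSet.inter (measurable_cubeIndex B (k₀ + j + 1)
      (Set.to_countable (lightCubes μ K c B (k₀ + j))).measurableSet)
  set count : ℕ → Rn n → ℕ := fun l x =>
    ∑ j ∈ Finset.range (D * l), (E j).indicator (fun _ => (1 : ℕ)) x
  have hcm : ∀ l, Measurable (count l) := fun l =>
    Finset.measurable_fun_sum _ fun j _ => measurable_const.indicator (hEm j)
  set P : ℕ → Set (Rn n) := fun l => K ∩ {x | count l x ≤ l}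
  have hPm : ∀ l, MeasurableSet (P l) := fun l =>
    hK.measurableSet.inter (measurableSet_le (hcm l) measurable_const)
  have hPbound : ∀ l, μ K / 2 ≤ μ (P l) := by
    intro l
    -- Markov at level `l + 1`: the expected count is at most `l * μ K / 2`, and the positive factor
    -- `l + 1` can be cancelled even for `l = 0`.
    have hbad : μ {x | l + 1 ≤ count l x} ≤ μ K / 2 := by
      have h1 := mul_measure_le_sum_measure μ hEm (D * l) (l + 1)
      have hcQ : (D : ℝ≥0∞) * ((B ^ n : ℕ) * c * ((2 * n + 1) ^ n : ℕ) * μ U) ≤ μ K / 2 := by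
        calc (D : ℝ≥0∞) * ((B ^ n : ℕ) * c * ((2 * n + 1) ^ n : ℕ) * μ U)
            ≤ (D : ℝ≥0∞) * ((B ^ n : ℕ) * c * ((2 * n + 1) ^ n : ℕ) * (2 * μ K)) := by gcongr
          _ = (4 * D * (B ^ n : ℕ) * ((2 * n + 1) ^ n : ℕ) * c) * (μ K / 2) := by
              have : μ K = 2 * (μ K / 2) :=
                (ENNReal.mul_div_cancel two_ne_zero ENNReal.ofNat_ne_top).symm
              nth_rewrite 1 [this]
              ring
          _ = (Q * c) * (μ K / 2) := by rw [hQ]; push_cast; ring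
          _ ≤ 1 * (μ K / 2) := by gcongr; exact ENNReal.mul_inv_le_one _
          _ = _ := one_mul _
      have h2 : ((l + 1 : ℕ) : ℝ≥0∞) * μ {x | l + 1 ≤ count l x} ≤
          ((l + 1 : ℕ) : ℝ≥0∞) * (μ K / 2) := by
        refine h1.trans ((Finset.sum_le_sum fun j _ => hlight j).trans ?_)
        rw [Finset.sum_const, Finset.card_range, nsmul_eq_mul]
        calc ((D * l : ℕ) : ℝ≥0∞) * ((B ^ n : ℕ) * c * ((2 * n + 1) ^ n : ℕ) * μ U)
            = l * (D * ((B ^ n : ℕ) * c * ((2 * n + 1) ^ n : ℕ) * μ U)) := by push_cast; ring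
          _ ≤ ((l + 1 : ℕ) : ℝ≥0∞) * (μ K / 2) := by gcongr; omega
      exact (ENNReal.mul_le_mul_iff_right (by simp) (ENNReal.natCast_ne_top _)).1 h2
    have hcover : μ K ≤ μ (P l) + μ K / 2 := by
      refine le_trans (measure_mono ?_) ((measure_union_le (P l) {x | l + 1 ≤ count l x}).trans
        (by gcongr))
      intro x hx
      rcases Nat.lt_or_ge l (count l x) with h | h
      · exact Or.inr h
      · exact Or.inl ⟨hx, h⟩
    have hfin : μ K / 2 ≠ ⊤ := ENNReal.div_ne_top (measure_ne_top μ _) two_ne_zero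
    rw [← ENNReal.add_halves (μ K)] at hcover
    simp only [ENNReal.add_halves] at hcover
    exact (ENNReal.add_le_add_iff_right hfin).1 (by rwa [ENNReal.add_halves])
  set Z := limsup P atTop with hZ
  have hZm : MeasurableSet Z := MeasurableSet.measurableSet_limsup hPm
  have hZpos : 0 < μ Z := (ENNReal.half_pos hK0.ne').trans_le (le_measure_limsup μ hPm hPbound)
  have hPF : ∀ l, ∀ x ∈ P l, cubeIndex B (k₀ + D * l) x ∈ F l := by
    rintro l x ⟨hxK, hx⟩
    refine hF l (fun j => cubeIndex B (k₀ + j) x) (hF₀ x hxK)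
      (fun j => cubeIndex_succ_mem_childIndices hB _ x) (le_trans ?_ hx)
    refine Finset.sum_le_sum fun j _ => ?_
    by_cases h : cubeIndex B (k₀ + j + 1) x ∈ lightCubes μ K c B (k₀ + j)
    · rw [Set.indicator_of_mem (show x ∈ E j from ⟨hxK, h⟩)]
      exact Set.indicator_le_self _ _ _
    · rw [Set.indicator_of_notMem (show cubeIndex B (k₀ + (j + 1)) x ∉ _ from h)]
      exact Nat.zero_le _
  have hnull : μH[(d : ℝ)] Z = 0 := by
    refine hausdorffMeasure_eq_zero_of_limsup hd0 F (fun l q => cube B (k₀ + D * l) q)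
      (A := (((2 * N) ^ D * B ^ n : ℕ) : ℝ≥0∞)) (ρ := ((B : ℝ≥0∞) ^ D)⁻¹) (a := F₀.card)
      (b := n) (ENNReal.natCast_ne_top _) (ENNReal.natCast_ne_top _) ?_ hrate ?_ ?_ ?_
    · rw [ENNReal.inv_lt_one]
      exact_mod_cast Nat.one_lt_pow hD0.ne' hB2
    · intro l
      have := hFcard l
      rw [pow_mul, mul_assoc, ← mul_pow] at this
      exact_mod_cast this
    · intro l q
      have h1 : Metric.ediam (cube (n := n) B (k₀ + D * l) q) ≤
          ENNReal.ofReal (n * ((B : ℝ) ^ (k₀ + D * l))⁻¹) := by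
        refine Metric.ediam_le fun x hx y hy => ?_
        rw [edist_dist, dist_eq_norm]
        exact ENNReal.ofReal_le_ofReal (norm_sub_le_of_mem_cube hB hx hy)
      refine h1.trans ?_
      have h2 : (n : ℝ) * ((B : ℝ) ^ (k₀ + D * l))⁻¹ ≤ n * ((B : ℝ) ^ (D * l))⁻¹ := by
        gcongr
        · exact hBr.le
        · omega
      refine (ENNReal.ofReal_le_ofReal h2).trans ?_
      rw [ENNReal.ofReal_mul (by positivity), ENNReal.ofReal_natCast,
        ENNReal.ofReal_inv_of_pos (by positivity), ENNReal.ofReal_pow (by positivity),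
        ENNReal.ofReal_natCast, ← ENNReal.inv_pow, ← pow_mul]
    · intro x hx
      rw [hZ, mem_limsup_iff_frequently_mem] at hx
      exact Frequently.mono hx fun l hl => ⟨_, hPF l x hl, rfl⟩
  refine (iInf₂_le_of_le Z hZm (iInf_le_of_le hZpos ?_))
  exact dimH_le_of_hausdorffMeasure_ne_top (by rw [hnull]; exact ENNReal.zero_ne_top)

/-! ### From the limsup to thin cones -/

theorem isThinAt_of_iInf_lt {n m : ℕ} {μ : Measure (Rn n)} [IsFiniteMeasure μ] {α r : ℝ}
    {c : ℝ≥0∞} {x : Rn n}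
    (h : ⨅ θ ∈ unitSphere n, ⨅ V ∈ grassmannian n (n - m),
      μ (truncCone x r V α \ H x θ α) / μ (Metric.closedBall x r) < c) :
    IsThinAt μ m α c r x := by
  simp only [iInf_lt_iff] at h
  obtain ⟨θ, hθ, V, hV, h⟩ := h
  refine ⟨θ, hθ, V, hV, ?_⟩
  rcases eq_or_ne (μ (Metric.closedBall x r)) 0 with h0 | h0
  -- For a null ball the quotient is `0 / 0` and gives no information, but both sides of the product
  -- form vanish.
  · have hsub : truncCone x r V α \ H x θ α ⊆ Metric.closedBall x r :=
      Set.sdiff_subset.trans Set.inter_subset_left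
    rw [measure_mono_null hsub h0]
    exact zero_le
  · exact (ENNReal.div_le_iff h0 (measure_ne_top μ _)).1 h.le

end ConicalDensity

theorem theorem4p1 (n m : ℕ) (hm : m < n) (s : ℝ) (hs : (m : ℝ) < s)
    (α : ℝ) (hα0 : 0 < α) (hα1 : α ≤ 1) :
    ∃ c : ℝ, 0 < c ∧
      ∀ (μ : Measure (ConicalDensity.Rn n)) [IsFiniteMeasure μ],
        ENNReal.ofReal s ≤ ConicalDensity.hausdorffDim μ →
          ∀ᵐ x ∂μ,
            ENNReal.ofReal c <
              limsup (fun r : ℝ =>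
                ⨅ θ ∈ ConicalDensity.unitSphere n,
                  ⨅ V ∈ ConicalDensity.grassmannian n (n - m),
                    μ (ConicalDensity.truncCone x r V α \ ConicalDensity.H x θ α) /
                      μ (Metric.closedBall x r))
                (𝓝[>] (0 : ℝ)) := by
  obtain ⟨d, hmd, hds⟩ := exists_between hs
  lift d to NNReal using (Nat.cast_nonneg m).trans hmd.le
  obtain ⟨c, hc0, hctop, hc⟩ :=
    ConicalDensity.exists_hausdorffDim_le_of_isThinAt n m hm hα0 hmd
  -- Halving leaves room: a limsup at most `c / 2` is strictly below `c`, so the quotient's infimum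
  -- is eventually below `c`.
  refine ⟨(c / 2).toReal, ENNReal.toReal_pos (ENNReal.half_pos hc0.ne').ne'
    (ENNReal.div_ne_top hctop two_ne_zero), fun μ _ hμ => ?_⟩
  rw [ENNReal.ofReal_toReal (ENNReal.div_ne_top hctop two_ne_zero)]
  by_contra hcon
  rw [ae_iff] at hcon
  let S : ℕ → Set (ConicalDensity.Rn n) := fun j =>
    {x | ∀ r, 0 < r → r < 1 / ((j : ℝ) + 1) → ConicalDensity.IsThinAt μ m α c r x}
  have hsub : {x | ¬ c / 2 < limsup (fun r : ℝ =>
      ⨅ θ ∈ ConicalDensity.unitSphere n, ⨅ V ∈ ConicalDensity.grassmannian n (n - m),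
        μ (ConicalDensity.truncCone x r V α \ ConicalDensity.H x θ α) /
          μ (Metric.closedBall x r)) (𝓝[>] (0 : ℝ))} ⊆ ⋃ j, S j := by
    intro x hx
    have h1 := eventually_lt_of_limsup_lt
      ((not_lt.1 hx).trans_lt (ENNReal.half_lt_self hc0.ne' hctop))
    obtain ⟨u, hu, h2⟩ := mem_nhdsGT_iff_exists_Ioo_subset.1 h1
    obtain ⟨j, hj⟩ := exists_nat_one_div_lt (Set.mem_Ioi.1 hu)
    exact Set.mem_iUnion.2 ⟨j, fun r hr hrj =>
      ConicalDensity.isThinAt_of_iInf_lt (h2 ⟨hr, hrj.trans hj⟩)⟩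
  obtain ⟨j, hj⟩ : ∃ j, μ (S j) ≠ 0 := by
    by_contra hall
    push Not at hall
    exact hcon (measure_mono_null hsub (measure_iUnion_null hall))
  have hle := hμ.trans (hc μ (S j) _ (by positivity) hj fun x hx => hx)
  rw [← ENNReal.ofReal_coe_nnreal] at hle
  exact absurd hle (not_le.2 ((ENNReal.ofReal_lt_ofReal_iff (d.coe_nonneg.trans_lt hds)).2 hds))
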